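/- Let $(\Omega,\mathcal A,m)$ be a measure space, let $A\colon L^2(\Omega)\to L^2(\Omega)$ be a bounded linear operator on the real space $L^2(\Omega)$, let $F_u,F_w,F_\xi\in L^2(\Omega)$, let $\Omega=\Omega^{0+}\cup\Omega^{00}\cup\Omega^{+0}$ be a partition into measurable (possibly empty) sets, and let $\Omega_w\subset\Omega$ be measurable. Consider the linear problem with complementarity constraints $$ \begin{aligned} \min_{u,w,\xi\in L^2(\Omega)}\quad & \langle F_u,u\rangle+\langle F_w,w\rangle+\langle F_\xi,\xi\rangle\\ \text{s.t.}\quad & Au-w-\xi=0,\\ & u=0\ \text{a.e. on }\Omega^{0+},\qquad \xi=0\ \text{a.e. on }\Omega^{+0},\\ & u\ge 0,\ \ \xi\ge 0,\ \ u\,\xi=0\ \text{ a.e. on }\Omega^{00},\\ & w\ge 0\ \text{a.e. on }\Omega_w . \end{aligned} \tag{MPCC$_{\mathrm{lin}}$} $$ A feasible point $(u,w,\xi)$ is called M-stationary if there exist multipliers $p,\mu,\nu,\lambda\in L^2(\Omega)$ with $$ \begin{gathered} F_u+A^*p+\mu=0,\qquad F_w-p+\lambda=0,\qquad F_\xi-p+\nu=0,\\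 \lambda\le 0\ \text{a.e. on }\Omega_w,\qquad \lambda=0\ \text{a.e. on }(\Omega\setminus\Omega_w)\cup(\Omega_w\cap\{w>0\}),\\ \mu=0\ \text{a.e. on }\Omega^{+0}\cup(\Omega^{00}\cap\{u>0\}),\qquad \nu=0\ \text{a.e. on }\Omega^{0+}\cup(\Omega^{00}\cap\{\xi>0\}),\\ (\mu<0\ \wedge\ \nu<0)\ \vee\ \mu\nu=0\quad\text{a.e. on }\Omega^{00}\cap\{u=\xi=0\}. \end{gathered} $$ (At $(u,w,\xi)=(0,0,0)$ the conditions involving $\{w>0\}$, $\{u>0\}$ and $\{\xi>0\}$ are void, and the last condition is required a.e. on all of $\Omega^{00}$.) Suppose that $A^*v\ge 0$ a.e. on $\Omega$ for every $v\in L^2(\Omega)$ with $v\ge 0$ a.e. on $\Omega$, and that $m(\Omega^{+0})=0$. If $(0,0,0)$ is a global minimizer of (MPCC$_{\mathrm{lin}}$), then $(0,0,0)$ is an M-stationary point of (MPCC$_{\mathrm{lin}}$). -/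

import Mathlib

open MeasureTheory

/-- The data of the linear MPCC over a measure space `(Ω, 𝒜, m)`:
minimize `⟨F_u, u⟩ + ⟨F_w, w⟩ + ⟨F_ξ, ξ⟩` over `u, w, ξ ∈ L²(Ω)` subject to
`A u - w - ξ = 0`, `u = 0` a.e. on `Ω⁰⁺`, `0 ≤ u ⟂ ξ ≥ 0` a.e. on `Ω⁰⁰`,
`ξ = 0` a.e. on `Ω⁺⁰`, and `w ≥ 0` a.e. on `Ω_w`. The sets `Ω⁰⁺`, `Ω⁰⁰`, `Ω⁺⁰` (here `S0p`, `S00`,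
`Sp0`) form a measurable partition of `Ω` (parts may be empty), and `Ω_w` (here `Sw`)
is measurable. -/
structure LinearMPCC {Ω : Type*} [MeasurableSpace Ω] (m : Measure Ω) where
  A : Lp ℝ 2 m →L[ℝ] Lp ℝ 2 m
  Fu : Lp ℝ 2 m
  Fw : Lp ℝ 2 m
  Fxi : Lp ℝ 2 m
  S0p : Set Ω
  S00 : Set Ω
  Sp0 : Set Ω
  Sw : Set Ω
  measurableSet_S0p : MeasurableSet S0p
  measurableSet_S00 : MeasurableSet S00
  measurableSet_Sp0 : MeasurableSet Sp0
  measurableSet_Sw : MeasurableSet Sw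
  disjoint_S0p_S00 : Disjoint S0p S00
  disjoint_S0p_Sp0 : Disjoint S0p Sp0
  disjoint_S00_Sp0 : Disjoint S00 Sp0
  union_eq_univ : S0p ∪ S00 ∪ Sp0 = Set.univ

namespace LinearMPCC

variable {Ω : Type*} [MeasurableSpace Ω] {m : Measure Ω}

/-- The objective `⟨F_u, u⟩ + ⟨F_w, w⟩ + ⟨F_ξ, ξ⟩`. -/
noncomputable def objective (P : LinearMPCC m) (u w xi : Lp ℝ 2 m) : ℝ :=
  inner ℝ P.Fu u + inner ℝ P.Fw w + inner ℝ P.Fxi xi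

/-- Feasibility of `(u, w, ξ)`. -/
structure Feasible (P : LinearMPCC m) (u w xi : Lp ℝ 2 m) : Prop where
  state_eq : P.A u - w - xi = 0
  u_eq_zero : ∀ᵐ ω ∂m, ω ∈ P.S0p → u ω = 0
  compl : ∀ᵐ ω ∂m, ω ∈ P.S00 → 0 ≤ u ω ∧ u ω * xi ω = 0 ∧ 0 ≤ xi ω
  xi_eq_zero : ∀ᵐ ω ∂m, ω ∈ P.Sp0 → xi ω = 0
  w_nonneg : ∀ᵐ ω ∂m, ω ∈ P.Sw → 0 ≤ w ω

/-- `(u, w, ξ)` is a (global) minimizer. -/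
def IsMinimizer (P : LinearMPCC m) (u w xi : Lp ℝ 2 m) : Prop :=
  P.Feasible u w xi ∧
    ∀ u' w' xi' : Lp ℝ 2 m, P.Feasible u' w' xi' → P.objective u w xi ≤ P.objective u' w' xi'

/-- `p, mu, nu, lam` are weakly stationary multipliers at `(u, w, ξ)`: `p` belongs to the state
equation, `mu` to the constraints on `u` (those on `Ω⁰⁺` and `Ω⁰⁰`), `nu` to the constraints on `ξ`
(those on `Ω⁺⁰` and `Ω⁰⁰`), and `lam` to `w ≥ 0` on `Ω_w`; each of the last three is extended by
zero to all of `Ω`. -/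
structure WeaklyStationaryMultipliers (P : LinearMPCC m) (u w xi p mu nu lam : Lp ℝ 2 m) :
    Prop where
  eq_u : P.Fu + ContinuousLinearMap.adjoint P.A p + mu = 0
  eq_w : P.Fw - p + lam = 0
  eq_xi : P.Fxi - p + nu = 0
  lam_nonpos : ∀ᵐ ω ∂m, ω ∈ P.Sw → lam ω ≤ 0
  lam_eq_zero : ∀ᵐ ω ∂m, ω ∉ P.Sw → lam ω = 0
  lam_eq_zero_of_pos : ∀ᵐ ω ∂m, ω ∈ P.Sw → 0 < w ω → lam ω = 0
  mu_eq_zero : ∀ᵐ ω ∂m, ω ∈ P.Sp0 → mu ω = 0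
  mu_eq_zero_of_pos : ∀ᵐ ω ∂m, ω ∈ P.S00 → 0 < u ω → mu ω = 0
  nu_eq_zero : ∀ᵐ ω ∂m, ω ∈ P.S0p → nu ω = 0
  nu_eq_zero_of_pos : ∀ᵐ ω ∂m, ω ∈ P.S00 → 0 < xi ω → nu ω = 0

/-- `(u, w, ξ)` is an M-stationary point: it is feasible and there are weakly stationary
multipliers with `(mu < 0 ∧ nu < 0) ∨ mu * nu = 0` a.e. on the biactive set
`{ω ∈ Ω⁰⁰ | u ω = ξ ω = 0}`. -/
def IsMStationary (P : LinearMPCC m) (u w xi : Lp ℝ 2 m) : Prop :=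
  P.Feasible u w xi ∧
    ∃ p mu nu lam : Lp ℝ 2 m, P.WeaklyStationaryMultipliers u w xi p mu nu lam ∧
      ∀ᵐ ω ∂m, ω ∈ P.S00 → u ω = 0 → xi ω = 0 → (mu ω < 0 ∧ nu ω < 0) ∨ mu ω * nu ω = 0

end LinearMPCC

/-!
Only feasible points of two kinds are needed.

* With `u = 0` and `w = -ξ`, minimality of the origin says `⟨F_ξ - F_w, ξ⟩ ≥ 0`. Taking `ξ ≥ 0`
  supported off `Ω_w` and `ξ ≤ 0` supported on `Ω⁰⁺` gives `F_w ≤ F_ξ` off `Ω_w` and `F_ξ ≤ F_w` on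
  `Ω⁰⁺` (`LinearMPCC.Fw_le_Fxi_off_Sw`, `LinearMPCC.Fxi_le_Fw_on_S0p`).
* Let `C` be the part of `Ω⁰⁰` that is either outside `Ω_w` or satisfies `F_w ≤ F_ξ`. Given `u ≥ 0`
  supported on `C`, put `w = 1_C A u` and `ξ = 1_{Cᶜ} A u`. As `A` inherits positivity from `A*`,
  this point is feasible, and `u`, `ξ` are complementary because their supports are disjoint. Its
  objective value is `⟨F_u + A* p, u⟩` with `p = 1_C F_w + 1_{Cᶜ} F_ξ`, so `F_u + A* p ≥ 0` on `C`
  (`LinearMPCC.Fu_add_adjoint_nonneg_on`).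

This `p` is the multiplier of the state equation. Off `C` one has `ν = p - F_ξ = 0`; on `C` both
`μ = -(F_u + A* p)` and `ν = F_w - F_ξ` are nonpositive, and nonpositive numbers are either both
negative or have product zero. The sign of `λ = p - F_w` follows from the two pointwise inequalities
and the choice of `C`.

Inequalities are passed from inner products to points by testing with negative parts
(`nonneg_on_of_inner_nonneg`), which needs no σ-finiteness of the measure.
-/

section Lp

variable {Ω : Type*} [MeasurableSpace Ω] {m : Measure Ω}

/-- The product `1_S f` of `f ∈ L²` with the indicator function of a measurable set `S`. -/
noncomputable def lpIndicator {S : Set Ω} (hS : MeasurableSet S) (f : Lp ℝ 2 m) : Lp ℝ 2 m :=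
  ((Lp.memLp f).indicator hS).toLp _

lemma coeFn_lpIndicator {S : Set Ω} (hS : MeasurableSet S) (f : Lp ℝ 2 m) :
    lpIndicator hS f =ᵐ[m] S.indicator f :=
  MemLp.coeFn_toLp _

lemma lpIndicator_add_compl {S : Set Ω} (hS : MeasurableSet S) (f : Lp ℝ 2 m) :
    lpIndicator hS f + lpIndicator hS.compl f = f := by
  apply Lp.ext
  filter_upwards [coeFn_lpIndicator hS f, coeFn_lpIndicator hS.compl f,
    Lp.coeFn_add (lpIndicator hS f) (lpIndicator hS.compl f)] with ω h₁ h₂ h₃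
  rw [h₃, Pi.add_apply, h₁, h₂, Set.indicator_self_add_compl_apply]

lemma inner_lpIndicator {S : Set Ω} (hS : MeasurableSet S) (f g : Lp ℝ 2 m) :
    inner ℝ f (lpIndicator hS g) = inner ℝ (lpIndicator hS f) g := by
  rw [L2.inner_def, L2.inner_def]
  apply integral_congr_ae
  filter_upwards [coeFn_lpIndicator hS f, coeFn_lpIndicator hS g] with ω h₁ h₂
  rw [h₁, h₂]
  by_cases h : ω ∈ S <;> simp [h]

lemma inner_nonneg_of_ae_nonneg {f g : Lp ℝ 2 m} (hf : ∀ᵐ ω ∂m, 0 ≤ f ω)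
    (hg : ∀ᵐ ω ∂m, 0 ≤ g ω) : 0 ≤ (inner ℝ f g : ℝ) := by
  rw [L2.inner_def]
  apply integral_nonneg_of_ae
  filter_upwards [hf, hg] with ω h₁ h₂
  exact mul_nonneg h₂ h₁

/-- The cone of nonnegative `L²` functions supported on `S` has as dual cone the functions that are
nonnegative on `S`. -/
lemma nonneg_on_of_inner_nonneg {S : Set Ω} (hS : MeasurableSet S) (f : Lp ℝ 2 m)
    (h : ∀ g : Lp ℝ 2 m, (∀ᵐ ω ∂m, 0 ≤ g ω) → (∀ᵐ ω ∂m, ω ∉ S → g ω = 0) →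
      0 ≤ (inner ℝ f g : ℝ)) :
    ∀ᵐ ω ∂m, ω ∈ S → 0 ≤ f ω := by
  -- The test function is `1_S f⁻`, for which `f * g = -g²`.
  set g : Lp ℝ 2 m := lpIndicator hS (Lp.negPart f)
  have hg : ∀ᵐ ω ∂m, g ω = S.indicator (fun x ↦ max (-f x) 0) ω := by
    filter_upwards [coeFn_lpIndicator hS (Lp.negPart f), Lp.coeFn_negPart_eq_max f] with ω h₁ h₂
    rw [h₁]
    by_cases hω : ω ∈ S <;> simp [hω, h₂]
  have hfg : (inner ℝ f g : ℝ) = -inner ℝ g g := by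
    rw [← inner_neg_left, L2.inner_def, L2.inner_def]
    apply integral_congr_ae
    filter_upwards [hg, Lp.coeFn_neg g] with ω h₁ h₂
    rw [h₂, Pi.neg_apply, h₁]
    by_cases hω : ω ∈ S
    · rcases le_total 0 (f ω) with h₀ | h₀ <;> simp [hω, h₀]
    · simp [hω]
  have hnonneg := h g
    (by
      filter_upwards [hg] with ω h₁
      rw [h₁]
      exact Set.indicator_nonneg (fun _ _ ↦ le_max_right _ _) ω)
    (by
      filter_upwards [hg] with ω h₁ hω
      simp [h₁, hω])
  have hg0 : g = 0 :=
    inner_self_eq_zero (𝕜 := ℝ).mp (le_antisymm (by linarith) real_inner_self_nonneg)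
  filter_upwards [hg, Lp.coeFn_zero ℝ 2 m] with ω h₁ h₂ hω
  rw [hg0, h₂, Set.indicator_of_mem hω] at h₁
  have h₃ : -f ω ≤ 0 := (le_max_left _ _).trans_eq h₁.symm
  linarith

/-- An operator on `L²` is positive if its adjoint is. -/
lemma ae_nonneg_of_adjoint_positive (A : Lp ℝ 2 m →L[ℝ] Lp ℝ 2 m)
    (hA : ∀ v : Lp ℝ 2 m, (∀ᵐ ω ∂m, 0 ≤ v ω) →
      ∀ᵐ ω ∂m, 0 ≤ (ContinuousLinearMap.adjoint A v) ω)
    {u : Lp ℝ 2 m} (hu : ∀ᵐ ω ∂m, 0 ≤ u ω) : ∀ᵐ ω ∂m, 0 ≤ A u ω := by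
  have h := nonneg_on_of_inner_nonneg MeasurableSet.univ (A u) fun g hg _ ↦ by
    rw [← ContinuousLinearMap.adjoint_inner_right]
    exact inner_nonneg_of_ae_nonneg hu (hA g hg)
  simpa using h

end Lp

namespace LinearMPCC

variable {Ω : Type*} [MeasurableSpace Ω] {m : Measure Ω} {P : LinearMPCC m}

lemma IsMinimizer.objective_nonneg (hmin : P.IsMinimizer 0 0 0) {u w xi : Lp ℝ 2 m}
    (h : P.Feasible u w xi) : 0 ≤ P.objective u w xi := by
  simpa [objective] using hmin.2 u w xi h

lemma ae_notMem_Sp0 (hnull : m P.Sp0 = 0) : ∀ᵐ ω ∂m, ω ∉ P.Sp0 :=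
  measure_eq_zero_iff_ae_notMem.mp hnull

/-- Feasible points with `u = 0` reduce minimality to a sign condition on `⟨F_ξ - F_w, ξ⟩`. -/
lemma IsMinimizer.inner_sub_nonneg (hmin : P.IsMinimizer 0 0 0) (hnull : m P.Sp0 = 0)
    {xi : Lp ℝ 2 m} (h₀₀ : ∀ᵐ ω ∂m, ω ∈ P.S00 → 0 ≤ xi ω)
    (hw : ∀ᵐ ω ∂m, ω ∈ P.Sw → xi ω ≤ 0) :
    0 ≤ (inner ℝ (P.Fxi - P.Fw) xi : ℝ) := by
  have hfeas : P.Feasible 0 (-xi) xi := by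
    refine ⟨by simp, ?_, ?_, ?_, ?_⟩
    · filter_upwards [Lp.coeFn_zero ℝ 2 m] with ω h _
      simpa using h
    · filter_upwards [Lp.coeFn_zero ℝ 2 m, h₀₀] with ω h h' hω
      rw [h]
      exact ⟨le_rfl, zero_mul _, h' hω⟩
    · filter_upwards [ae_notMem_Sp0 hnull] with ω h hω
      exact absurd hω h
    · filter_upwards [Lp.coeFn_neg xi, hw] with ω h h' hω
      rw [h]
      exact neg_nonneg.mpr (h' hω)
  have h := hmin.objective_nonneg hfeas
  simp only [objective, inner_zero_right, inner_neg_right] at h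
  rw [inner_sub_left]
  linarith

lemma Fw_le_Fxi_off_Sw (hmin : P.IsMinimizer 0 0 0) (hnull : m P.Sp0 = 0) :
    ∀ᵐ ω ∂m, ω ∉ P.Sw → P.Fw ω ≤ P.Fxi ω := by
  have h := nonneg_on_of_inner_nonneg P.measurableSet_Sw.compl (P.Fxi - P.Fw) fun g hg hg' ↦
    hmin.inner_sub_nonneg hnull (hg.mono fun _ h _ ↦ h)
      (hg'.mono fun _ h hω ↦ (h fun hc ↦ hc hω).le)
  filter_upwards [h, Lp.coeFn_sub P.Fxi P.Fw] with ω h₁ h₂ hω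
  have h₃ := h₁ hω
  rw [h₂, Pi.sub_apply] at h₃
  linarith

lemma Fxi_le_Fw_on_S0p (hmin : P.IsMinimizer 0 0 0) (hnull : m P.Sp0 = 0) :
    ∀ᵐ ω ∂m, ω ∈ P.S0p → P.Fxi ω ≤ P.Fw ω := by
  have h := nonneg_on_of_inner_nonneg P.measurableSet_S0p (P.Fw - P.Fxi) fun g hg hg' ↦ by
    have h := hmin.inner_sub_nonneg hnull (xi := -g)
      (by
        filter_upwards [hg', Lp.coeFn_neg g] with ω h₁ h₂ hω
        rw [h₂, Pi.neg_apply, h₁ fun h ↦ Set.disjoint_left.mp P.disjoint_S0p_S00 h hω, neg_zero])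
      (by
        filter_upwards [hg, Lp.coeFn_neg g] with ω h₁ h₂ _
        rw [h₂]
        exact neg_nonpos.mpr h₁)
    rwa [inner_neg_right, ← inner_neg_left, neg_sub] at h
  filter_upwards [h, Lp.coeFn_sub P.Fw P.Fxi] with ω h₁ h₂ hω
  have h₃ := h₁ hω
  rw [h₂, Pi.sub_apply] at h₃
  linarith

/-- For `u ≥ 0` supported on a part `C` of `Ω⁰⁰`, splitting `A u` into `w` on `C` and `ξ` off `C`
gives a feasible point, and testing minimality with these points determines the sign of
`F_u + A* p` on `C`, where `p` is `F_w` on `C` and `F_ξ` off `C`. -/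
lemma Fu_add_adjoint_nonneg_on (hmin : P.IsMinimizer 0 0 0) (hnull : m P.Sp0 = 0)
    (hA : ∀ v : Lp ℝ 2 m, (∀ᵐ ω ∂m, 0 ≤ v ω) →
      ∀ᵐ ω ∂m, 0 ≤ (ContinuousLinearMap.adjoint P.A v) ω)
    {C : Set Ω} (hC : MeasurableSet C) (hC₀ : C ⊆ P.S00) :
    ∀ᵐ ω ∂m, ω ∈ C → 0 ≤ (P.Fu + ContinuousLinearMap.adjoint P.A
      (lpIndicator hC P.Fw + lpIndicator hC.compl P.Fxi)) ω := by
  refine nonneg_on_of_inner_nonneg hC _ fun u hu hu' ↦ ?_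
  have hAu := ae_nonneg_of_adjoint_positive P.A hA hu
  have hw := coeFn_lpIndicator hC (P.A u)
  have hxi := coeFn_lpIndicator hC.compl (P.A u)
  have hfeas : P.Feasible u (lpIndicator hC (P.A u)) (lpIndicator hC.compl (P.A u)) := by
    refine ⟨?_, ?_, ?_, ?_, ?_⟩
    · rw [sub_sub, lpIndicator_add_compl, sub_self]
    · filter_upwards [hu'] with ω h hω
      exact h fun hc ↦ Set.disjoint_left.mp P.disjoint_S0p_S00 hω (hC₀ hc)
    · filter_upwards [hu, hu', hAu, hxi] with ω h₁ h₂ h₃ h₄ _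
      rw [h₄]
      by_cases hω : ω ∈ C
      · simp [hω, h₁]
      · simp [hω, h₂ hω, h₃]
    · filter_upwards [ae_notMem_Sp0 hnull] with ω h hω
      exact absurd hω h
    · filter_upwards [hAu, hw] with ω h₁ h₂ _
      rw [h₂]
      exact Set.indicator_apply_nonneg fun _ ↦ h₁
  have h := hmin.objective_nonneg hfeas
  rw [objective, inner_lpIndicator, inner_lpIndicator] at h
  rw [inner_add_left, ContinuousLinearMap.adjoint_inner_left, inner_add_left]
  linarith

end LinearMPCC

open LinearMPCC in
theorem mainTheorem3 {Ω : Type*} [MeasurableSpace Ω] (m : Measure Ω) (P : LinearMPCC m)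
    (hA : ∀ v : Lp ℝ 2 m, (∀ᵐ ω ∂m, 0 ≤ v ω) →
      ∀ᵐ ω ∂m, 0 ≤ (ContinuousLinearMap.adjoint P.A v) ω)
    (hnull : m P.Sp0 = 0)
    (hmin : P.IsMinimizer 0 0 0) :
    P.IsMStationary 0 0 0 := by
  set C : Set Ω := P.S00 ∩ (P.Swᶜ ∪ {ω | P.Fw ω ≤ P.Fxi ω})
  have hC : MeasurableSet C :=
    P.measurableSet_S00.inter (P.measurableSet_Sw.compl.union
      (measurableSet_le (Lp.stronglyMeasurable P.Fw).measurable
        (Lp.stronglyMeasurable P.Fxi).measurable))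
  have hμ := Fu_add_adjoint_nonneg_on hmin hnull hA hC Set.inter_subset_left
  set p : Lp ℝ 2 m := lpIndicator hC P.Fw + lpIndicator hC.compl P.Fxi
  have hp : ∀ᵐ ω ∂m, (ω ∈ C → p ω = P.Fw ω) ∧ (ω ∉ C → p ω = P.Fxi ω) := by
    filter_upwards [coeFn_lpIndicator hC P.Fw, coeFn_lpIndicator hC.compl P.Fxi,
      Lp.coeFn_add (lpIndicator hC P.Fw) (lpIndicator hC.compl P.Fxi)] with ω h₁ h₂ h₃
    rw [h₃, Pi.add_apply, h₁, h₂]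
    exact ⟨fun h ↦ by simp [h], fun h ↦ by simp [h]⟩
  set q : Lp ℝ 2 m := P.Fu + ContinuousLinearMap.adjoint P.A p
  have hnu := Lp.coeFn_sub p P.Fxi
  have hlam := Lp.coeFn_sub p P.Fw
  have hSp0 := ae_notMem_Sp0 hnull
  have hoff := Fw_le_Fxi_off_Sw hmin hnull
  have hon := Fxi_le_Fw_on_S0p hmin hnull
  -- Outside `Ω⁰⁰` only `Ω⁰⁺` matters, since `Ω⁺⁰` is a null set.
  have hcover : ∀ᵐ ω ∂m, ω ∈ P.S0p ∨ ω ∈ P.S00 := by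
    filter_upwards [hSp0] with ω h
    have hω : ω ∈ P.S0p ∪ P.S00 ∪ P.Sp0 := P.union_eq_univ ▸ Set.mem_univ ω
    exact hω.resolve_right h
  refine ⟨hmin.1, p, -q, p - P.Fxi, p - P.Fw,
    ⟨add_neg_cancel q, by abel, by abel, ?_, ?_, ?_, ?_, ?_, ?_, ?_⟩, ?_⟩
  · filter_upwards [hp, hlam, hcover, hon] with ω h₁ h₂ h₃ h₄ hω
    rw [h₂, Pi.sub_apply, sub_nonpos]
    by_cases hc : ω ∈ C
    · exact (h₁.1 hc).le
    · rw [h₁.2 hc]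
      rcases h₃ with h | h
      · exact h₄ h
      · exact (not_le.mp fun hle ↦ hc ⟨h, Or.inr hle⟩).le
  · filter_upwards [hp, hlam, hcover, hon, hoff] with ω h₁ h₂ h₃ h₄ h₅ hω
    rw [h₂, Pi.sub_apply, sub_eq_zero]
    by_cases hc : ω ∈ C
    · exact h₁.1 hc
    · rw [h₁.2 hc]
      rcases h₃ with h | h
      · exact le_antisymm (h₄ h) (h₅ hω)
      · exact absurd ⟨h, Or.inl hω⟩ hc
  · filter_upwards [Lp.coeFn_zero ℝ 2 m] with ω h _ hpos
    rw [h] at hpos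
    exact absurd hpos (lt_irrefl 0)
  · filter_upwards [hSp0] with ω h hω
    exact absurd hω h
  · filter_upwards [Lp.coeFn_zero ℝ 2 m] with ω h _ hpos
    rw [h] at hpos
    exact absurd hpos (lt_irrefl 0)
  · filter_upwards [hp, hnu] with ω h₁ h₂ hω
    rw [h₂, Pi.sub_apply, sub_eq_zero]
    exact h₁.2 fun hc ↦ Set.disjoint_left.mp P.disjoint_S0p_S00 hω hc.1
  · filter_upwards [Lp.coeFn_zero ℝ 2 m] with ω h _ hpos
    rw [h] at hpos
    exact absurd hpos (lt_irrefl 0)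
  · filter_upwards [hp, hnu, hμ, hoff, Lp.coeFn_neg q] with ω h₁ h₂ h₃ h₄ h₅ _ _ _
    rw [h₂, h₅, Pi.sub_apply, Pi.neg_apply]
    by_cases hc : ω ∈ C
    · have hle : P.Fw ω ≤ P.Fxi ω := hc.2.elim (fun h ↦ h₄ h) id
      rw [h₁.1 hc]
      rcases (h₃ hc).eq_or_lt with h | h
      · exact Or.inr (by simp [← h])
      · rcases hle.eq_or_lt with h' | h'
        · exact Or.inr (by simp [h'])
        · exact Or.inl ⟨neg_lt_zero.mpr h, sub_neg.mpr h'⟩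
    · exact Or.inr (by simp [h₁.2 hc])
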